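/- **Theorem.** There is a universal constant $c>0$ such that for all integers $n,m\ge 0$, every set $S$, every relation $f\subseteq\{0,1\}^n\times S$ and every partial Boolean function $g\subseteq\{0,1\}^m\times\{0,1\}$, $$R_{1/3}(f\circ g^n)\;\ge\; c\cdot R_{4/9}(f)\cdot\bar\chi(g).$$ Here the notions are as follows. *Query complexity.* A deterministic query algorithm is a binary decision tree which queries bits of its input and outputs the label of the leaf it reaches; a randomized query algorithm is a probability distribution over deterministic ones. For a relation $h\subseteq\{0,1\}^k\times S$, a randomized query algorithm $\mathcal A$ computes $h$ with error $\epsilon$ if $\Pr[(x,\mathcal A(x))\in h]\ge 1-\epsilon$ for all $x\in\{0,1\}^k$, and $R_\epsilon(h)$ is the minimum, over all such $\mathcal A$, of the maximal number of queries over all inputs and all internal randomness ($\infty$ if there is no such $\mathcal A$). A deterministic tree $T$ computes $h$ if $(x,T(x))\in h$ for all $x$. *Partial functions and composition.* For $g\subseteq\{0,1\}^m\times\{0,1\}$ let $g^{-1}(b)$ be the set of $x$ with $(x,b)\in g$ and $(x,\bar b)\notin g$. The strings in $g^{-1}(0)\cup g^{-1}(1)$ are the valid inputs; for these $g(x)$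 denotes the unique $b$ with $(x,b)\in g$. $g$ is a partial Boolean function if $(y,0),(y,1)\in g$ for every $y$ which is not valid. For $x=(x_1,\dots,x_n)\in(\{0,1\}^m)^n$ and $s\in S$, $(x,s)\in f\circ g^n$ iff some $x_i$ is not valid, or all $x_i$ are valid and $((g(x_1),\dots,g(x_n)),s)\in f$. *Max conflict complexity.* Let $\mu_0,\mu_1$ be probability distributions supported in $g^{-1}(0)$ and $g^{-1}(1)$, and let $T$ be a deterministic tree computing $g$. For an inner vertex $v$ of $T$ querying the index $q(v)$, let $d(v)$ be its depth (the root has depth $1$), let $p_b(v)=\Pr_{x\sim\mu_b}[x_{q(v)}=0\mid x\text{ reaches }v]$, and $\Delta(v)=|p_0(v)-p_1(v)|$. Let $R(v)=1$ for the root, and for a child $v$ of $w$ let $R(v)=R(w)\cdot\min_{b}\Pr_{x\sim\mu_b}[x\text{ reaches }v\mid x\text{ reaches }w]$ (vertices that are reached with probability $0$ under $\mu_0$ or $\mu_1$ have $R(v)=0$). Put $\chi(T,(\mu_0,\mu_1))=\sum_v d(v)\,\Delta(v)\,R(v)$, where $v$ ranges over the inner vertices of $T$. Then $$\bar\chi(g)=\max_{\mathcal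 Q}\;\min_T\;\mathbb E_{(\mu_0,\mu_1)\sim\mathcal Q}\big[\chi(T,(\mu_0,\mu_1))\big],$$ where $\mathcal Q$ ranges over the (discrete) probability distributions over pairs $(\mu_0,\mu_1)$ such that $\mathrm{supp}(\mu_0)\subseteq g^{-1}(0)$ and $\mathrm{supp}(\mu_1)\subseteq g^{-1}(1)$ for each pair in the support of $\mathcal Q$, and $T$ ranges over the deterministic trees computing $g$ (if $g^{-1}(0)$ or $g^{-1}(1)$ is empty, no $\mathcal Q$ exists, and $\bar\chi(g)=0$; conventionally $0\cdot\infty=0$). -/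

import Mathlib

open scoped ENNReal

namespace QueryComplexity

/-- Deterministic query algorithms (binary decision trees) on inputs `x : ι → Bool` with outputs
in `S`. At an inner vertex `query i t₀ t₁` the bit `x i` is queried and the computation goes on
with `t₀` on answer `0` (`false`) and with `t₁` on answer `1` (`true`). -/
inductive DecisionTree (ι : Type*) (S : Type*) where
  | leaf (s : S) : DecisionTree ι S
  | query (i : ι) (t₀ t₁ : DecisionTree ι S) : DecisionTree ι S

namespace DecisionTree

variable {ι S : Type*}

/-- The output of the tree on input `x`. -/
def output : DecisionTree ι S → (ι → Bool) → S
  | leaf s, _ => s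
  | query i t₀ t₁, x => if x i then t₁.output x else t₀.output x

/-- The number of queries that the tree makes on input `x`. -/
def numQueries : DecisionTree ι S → (ι → Bool) → ℕ
  | leaf _, _ => 0
  | query i t₀ t₁, x => (if x i then t₁.numQueries x else t₀.numQueries x) + 1

/-- The tree computes the relation `h`. -/
def Computes (T : DecisionTree ι S) (h : Set ((ι → Bool) × S)) : Prop :=
  ∀ x, (x, T.output x) ∈ h

end DecisionTree

/-- A randomized query algorithm is a probability distribution over deterministic ones. -/
abbrev RandomizedAlgorithm (ι S : Type*) := PMF (DecisionTree ι S)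

/-- The randomized algorithm `A` computes `h` with error `ε`:
on every input `x` its output is correct with probability at least `1 - ε`. -/
def ComputesWithError {ι S : Type*} (A : RandomizedAlgorithm ι S) (h : Set ((ι → Bool) × S))
    (ε : ℝ) : Prop :=
  ∀ x : ι → Bool, ENNReal.ofReal (1 - ε) ≤ A.toOuterMeasure {T | (x, T.output x) ∈ h}

/-- The bounded-error randomized query complexity `R_ε(h)`: the minimum, over all randomized query
algorithms computing `h` with error `ε`, of the maximal number of queries over all inputs and all
outcomes of the internal randomness. It is `⊤` if no such algorithm exists, which
for `0 ≤ ε < 1` happens exactly when some input has no correct output. -/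
noncomputable def randQueryComplexity {ι S : Type*} (ε : ℝ) (h : Set ((ι → Bool) × S)) : ℕ∞ :=
  sInf {q : ℕ∞ | ∃ A : RandomizedAlgorithm ι S, ComputesWithError A h ε ∧
    ∀ T ∈ A.support, ∀ x, (T.numQueries x : ℕ∞) ≤ q}

/-- For a relation `g ⊆ {0,1}^m × {0,1}`, the set `g⁻¹(b)` of the strings `x` with
`(x, b) ∈ g` and `(x, 1 - b) ∉ g`. -/
def preim {m : ℕ} (g : Set ((Fin m → Bool) × Bool)) (b : Bool) : Set (Fin m → Bool) :=
  {x | (x, b) ∈ g ∧ (x, !b) ∉ g}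

/-- The valid inputs `g⁻¹(0) ∪ g⁻¹(1)`. -/
def validInputs {m : ℕ} (g : Set ((Fin m → Bool) × Bool)) : Set (Fin m → Bool) :=
  preim g false ∪ preim g true

/-- A partial Boolean function, as a relation: both outputs are allowed on every string which is
not a valid input. -/
def IsPartialBooleanFunction {m : ℕ} (g : Set ((Fin m → Bool) × Bool)) : Prop :=
  ∀ y, y ∉ validInputs g → (y, false) ∈ g ∧ (y, true) ∈ g

/-- The `i`-th block `x_i ∈ {0,1}^m` of `x ∈ ({0,1}^m)^n`. -/
def block {n m : ℕ} (x : Fin n × Fin m → Bool) (i : Fin n) : Fin m → Bool :=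
  fun j => x (i, j)

/-- The composition `f ∘ g^n`. In the second alternative `z` is the string
`(g(x_1), …, g(x_n))`. -/
def compose {n m : ℕ} {S : Type*} (f : Set ((Fin n → Bool) × S))
    (g : Set ((Fin m → Bool) × Bool)) : Set ((Fin n × Fin m → Bool) × S) :=
  {p | (∃ i, block p.1 i ∉ validInputs g) ∨
    ∃ z : Fin n → Bool, (∀ i, block p.1 i ∈ preim g (z i)) ∧ (z, p.2) ∈ f}

/-- `Pr_{x ∼ μ}[x_i = b | x ∈ C]` (with value `0` if `C` has probability `0`). -/
noncomputable def condProb {m : ℕ} (μ : PMF (Fin m → Bool)) (C : Set (Fin m → Bool))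
    (i : Fin m) (b : Bool) : ℝ :=
  (μ.toOuterMeasure {x | x ∈ C ∧ x i = b} / μ.toOuterMeasure C).toReal

/-- The sum of `d(v) * Δ(v) * R(v)` over the inner vertices `v` of a subtree whose root `w` has
subcube `C` (the inputs that reach `w`), depth `d(w) = d` and `R(w) = r`. Here
`Δ(v) = |p_0(v) - p_1(v)|`, and `R` of the child of `v` on answer `b` is `R(v)` times the smaller
one of the probabilities under `μ₀` and `μ₁` of answer `b` conditioned on reaching `v`.
A vertex that has probability `0` under `μ₀` or `μ₁` has `R(v) = 0`, so the value of `condProb` for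
conditions of probability `0` plays no role. -/
noncomputable def conflictSum {m : ℕ} (μ₀ μ₁ : PMF (Fin m → Bool)) :
    DecisionTree (Fin m) Bool → Set (Fin m → Bool) → ℕ → ℝ → ℝ
  | .leaf _, _, _, _ => 0
  | .query i t₀ t₁, C, d, r =>
      d * |condProb μ₀ C i false - condProb μ₁ C i false| * r
        + conflictSum μ₀ μ₁ t₀ {x | x ∈ C ∧ x i = false} (d + 1)
            (r * min (condProb μ₀ C i false) (condProb μ₁ C i false))
        + conflictSum μ₀ μ₁ t₁ {x | x ∈ C ∧ x i = true} (d + 1)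
            (r * min (condProb μ₀ C i true) (condProb μ₁ C i true))

/-- `χ(T, (μ₀, μ₁)) = ∑_v d(v) * Δ(v) * R(v)`; the root has depth `1` and `R = 1`. -/
noncomputable def conflict {m : ℕ} (T : DecisionTree (Fin m) Bool)
    (μ₀ μ₁ : PMF (Fin m → Bool)) : ℝ :=
  conflictSum μ₀ μ₁ T Set.univ 1 1

/-- The expectation `χ(T, Q)` of `χ(T, (μ₀, μ₁))` over a pair `(μ₀, μ₁)` drawn from `Q`. -/
noncomputable def conflictExp {m : ℕ} (T : DecisionTree (Fin m) Bool)
    (Q : PMF (PMF (Fin m → Bool) × PMF (Fin m → Bool))) : ℝ≥0∞ :=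
  ∑' p, Q p * ENNReal.ofReal (conflict T p.1 p.2)

/-- `Q` is consistent with `g`: for each pair `(μ₀, μ₁)` in the support of `Q`, the supports of
`μ₀` and `μ₁` are contained in `g⁻¹(0)` and `g⁻¹(1)`. -/
def Consistent {m : ℕ} (g : Set ((Fin m → Bool) × Bool))
    (Q : PMF (PMF (Fin m → Bool) × PMF (Fin m → Bool))) : Prop :=
  ∀ p ∈ Q.support, p.1.support ⊆ preim g false ∧ p.2.support ⊆ preim g true

/-- The max conflict complexity of `g`: the maximum over all distributions `Q` over pairs of
distributions, consistent with `g`, of the minimum of `χ(T, Q)` over the deterministic trees `T`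
computing `g`. -/
noncomputable def maxConflict {m : ℕ} (g : Set ((Fin m → Bool) × Bool)) : ℝ≥0∞ :=
  ⨆ Q : PMF (PMF (Fin m → Bool) × PMF (Fin m → Bool)), ⨆ _ : Consistent g Q,
    ⨅ T : DecisionTree (Fin m) Bool, ⨅ _ : T.Computes g, conflictExp T Q

end QueryComplexity

namespace QueryComplexity

/-! An algorithm for `f ∘ g^n` is turned into one for `f`. For each block draw a pair of laws from a
near-optimal `Q` and run the given tree on blocks that are never fixed. A query to block `i` is
answered through the maximal coupling of the answers under the laws for hidden bit 0 and hidden bit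
1. If the two answers agree, both laws are conditioned on the answer; if they differ (a conflict),
the hidden bit `z i` is queried, and from then on only its law is used. On `z` the output has the
law of the original tree on blocks drawn from the laws for `z i`, so the error does not grow
(`expect_simulate_output`), and the expected number of queries is the expected number of conflicts
(`expect_simulate_numQueries`).

It remains to see that a conflict is expensive. The sum defining χ is the expected number of queries
up to the first conflict, because a tree computing `g` cannot reach a leaf without one
(`ofReal_conflictSum`). Fix a block, follow the tree's queries to it, and if no conflict has
occurred continue with a tree that is good for the remaining laws (`exists_tree_add_le`). The result
computes `g`, hence makes about χ or more expected queries, while the continuation costs at most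
about χ times the probability of no conflict. So χ times the conflict probability is at most the
expected number of queries to the block before its conflict, up to a small error. Summing over the
blocks bounds χ times the expected cost of the simulation by the cost of the given algorithm;
Markov's inequality gives a worst-case bound. -/

/-- The expectation of a nonnegative function under a probability mass function. -/
noncomputable def expect {α : Type*} (p : PMF α) (F : α → ℝ≥0∞) : ℝ≥0∞ := ∑' a, p a * F a

/-! ### Expectations under probability mass functions. -/

section Expect

variable {α β : Type*}

lemma expect_pure (a : α) (F : α → ℝ≥0∞) : expect (PMF.pure a) F = F a := by
  unfold expect
  rw [tsum_eq_single a]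
  · simp
  · intro b hb
    simp [PMF.pure_apply, hb]

lemma expect_bind (p : PMF α) (q : α → PMF β) (F : β → ℝ≥0∞) :
    expect (p.bind q) F = expect p fun a => expect (q a) F := by
  unfold expect
  simp only [PMF.bind_apply, ← ENNReal.tsum_mul_right, ← ENNReal.tsum_mul_left]
  rw [ENNReal.tsum_comm]
  simp only [mul_assoc]

lemma expect_map (p : PMF α) (q : α → β) (F : β → ℝ≥0∞) :
    expect (p.map q) F = expect p fun a => F (q a) := by
  rw [PMF.map, expect_bind]
  simp [expect_pure]

lemma expect_add (p : PMF α) (F G : α → ℝ≥0∞) :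
    expect p (fun a => F a + G a) = expect p F + expect p G := by
  simp only [expect, mul_add, ENNReal.tsum_add]

lemma expect_mul_left (p : PMF α) (c : ℝ≥0∞) (F : α → ℝ≥0∞) :
    expect p (fun a => c * F a) = c * expect p F := by
  simp only [expect, ← ENNReal.tsum_mul_left]
  exact tsum_congr fun a => mul_left_comm _ _ _

lemma expect_const (p : PMF α) (c : ℝ≥0∞) : expect p (fun _ => c) = c := by
  simp only [expect, ENNReal.tsum_mul_right, p.tsum_coe, one_mul]

lemma expect_mono (p : PMF α) {F G : α → ℝ≥0∞} (h : ∀ a ∈ p.support, F a ≤ G a) :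
    expect p F ≤ expect p G := by
  refine ENNReal.tsum_le_tsum fun a => ?_
  by_cases ha : p a = 0
  · simp [ha]
  · exact mul_le_mul_right (h a ((p.mem_support_iff a).2 ha)) _

lemma expect_sum {κ : Type*} (p : PMF α) (s : Finset κ) (F : κ → α → ℝ≥0∞) :
    expect p (fun a => ∑ k ∈ s, F k a) = ∑ k ∈ s, expect p (F k) := by
  classical
  induction s using Finset.induction_on with
  | empty => simp [expect]
  | insert k s hk ih => simp only [Finset.sum_insert hk, expect_add, ih]

lemma expect_fintype [Fintype α] (p : PMF α) (F : α → ℝ≥0∞) :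
    expect p F = ∑ a, p a * F a := tsum_fintype _

lemma expect_comm (p : PMF α) (q : PMF β) (F : α → β → ℝ≥0∞) :
    expect p (fun a => expect q (F a)) = expect q fun b => expect p fun a => F a b := by
  simp only [expect, ← ENNReal.tsum_mul_left]
  rw [ENNReal.tsum_comm]
  exact tsum_congr fun b => tsum_congr fun a => mul_left_comm _ _ _

lemma toOuterMeasure_eq_expect (p : PMF α) (s : Set α) :
    p.toOuterMeasure s = expect p (s.indicator 1) := by
  rw [PMF.toOuterMeasure_apply]
  refine tsum_congr fun a => ?_
  by_cases h : a ∈ s <;> simp [h]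

end Expect

/-! ### Independent samples. -/

section Product

variable {α : Type*}

lemma tsum_prod_insertNth {n : ℕ} (Q : PMF α) (k : Fin (n + 1)) (F : (Fin (n + 1) → α) → ℝ≥0∞) :
    ∑' σ : Fin (n + 1) → α, (∏ i, Q (σ i)) * F σ =
      expect Q fun a => ∑' τ : Fin n → α, (∏ i, Q (τ i)) * F (k.insertNth a τ) := by
  rw [← (Fin.insertNthEquiv (fun _ => α) k).tsum_eq, ENNReal.tsum_prod', expect]
  refine tsum_congr fun a => ?_
  rw [← ENNReal.tsum_mul_left]
  refine tsum_congr fun τ => ?_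
  simp [Fin.insertNthEquiv, Fin.prod_univ_succAbove _ k, mul_assoc]

lemma tsum_prod_eq_one (Q : PMF α) : ∀ n : ℕ, ∑' σ : Fin n → α, ∏ i, Q (σ i) = 1
  | 0 => by simp
  | n + 1 => by
    have h := tsum_prod_insertNth Q (0 : Fin (n + 1)) (fun _ => 1)
    simpa [tsum_prod_eq_one Q n, expect_const] using h

/-- The law of `n` independent samples from `Q`. -/
noncomputable def iid (Q : PMF α) (n : ℕ) : PMF (Fin n → α) :=
  ⟨fun σ => ∏ i, Q (σ i), by
    rw [← tsum_prod_eq_one Q n]; exact ENNReal.summable.hasSum⟩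

lemma iid_apply (Q : PMF α) {n : ℕ} (σ : Fin n → α) : iid Q n σ = ∏ i, Q (σ i) := rfl

lemma mem_support_of_mem_support_iid (Q : PMF α) {n : ℕ} {σ : Fin n → α}
    (h : σ ∈ (iid Q n).support) (i : Fin n) : σ i ∈ Q.support := by
  rw [PMF.mem_support_iff, iid_apply] at h
  exact (Q.mem_support_iff _).2 fun h0 => h (Finset.prod_eq_zero (Finset.mem_univ i) h0)

/-- Resampling one coordinate does not change the law of independent samples. -/
lemma expect_iid_resample (Q : PMF α) {n : ℕ} (k : Fin n) (F : (Fin n → α) → ℝ≥0∞) :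
    expect (iid Q n) F =
      expect (iid Q n) fun σ => expect Q fun a => F (Function.update σ k a) := by
  cases n with
  | zero => exact k.elim0
  | succ n =>
    have key : ∀ G : (Fin (n + 1) → α) → ℝ≥0∞, expect (iid Q (n + 1)) G =
        expect Q fun a => expect (iid Q n) fun τ => G (k.insertNth a τ) :=
      fun G => tsum_prod_insertNth Q k G
    rw [key, key]
    simp only [Fin.update_insertNth]
    rw [expect_const, expect_comm]

end Product

/-! ### Conditioning on a bit and the maximal coupling. -/

section Bit

variable {m : ℕ}

/-- The probability that bit `j` of a sample from `μ` is `b`. -/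
noncomputable def probBit (μ : PMF (Fin m → Bool)) (j : Fin m) (b : Bool) : ℝ≥0∞ :=
  ∑ x, if x j = b then μ x else 0

open Classical in
/-- `μ` conditioned on bit `j` being `b` (and `μ` itself if this has probability `0`). -/
noncomputable def condBit (μ : PMF (Fin m → Bool)) (j : Fin m) (b : Bool) :
    PMF (Fin m → Bool) :=
  if h : ∃ x ∈ {x : Fin m → Bool | x j = b}, x ∈ μ.support then
    μ.filter {x | x j = b} h else μ

lemma probBit_false_add_true (μ : PMF (Fin m → Bool)) (j : Fin m) :
    probBit μ j false + probBit μ j true = 1 := by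
  rw [probBit, probBit, ← Finset.sum_add_distrib, ← μ.tsum_coe, tsum_fintype]
  refine Finset.sum_congr rfl fun x _ => ?_
  cases x j <;> simp

lemma probBit_le_one (μ : PMF (Fin m → Bool)) (j : Fin m) (b : Bool) : probBit μ j b ≤ 1 := by
  rw [← probBit_false_add_true μ j]
  cases b
  · exact le_self_add
  · exact le_add_self

lemma probBit_ne_top (μ : PMF (Fin m → Bool)) (j : Fin m) (b : Bool) : probBit μ j b ≠ ⊤ :=
  ((probBit_le_one μ j b).trans_lt ENNReal.one_lt_top).ne

/-- In product form no positivity is needed: if the conditioning event has probability 0, both sides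
vanish whatever default `condBit` takes. -/
lemma probBit_mul_condBit (μ : PMF (Fin m → Bool)) (j : Fin m) (b : Bool) (x : Fin m → Bool) :
    probBit μ j b * condBit μ j b x = if x j = b then μ x else 0 := by
  classical
  have hs : probBit μ j b = ∑' y, {x : Fin m → Bool | x j = b}.indicator μ y := by
    rw [tsum_fintype]
    exact Finset.sum_congr rfl fun y _ => by simp [Set.indicator_apply]
  unfold condBit
  split_ifs with h hx hx
  · have h0 : probBit μ j b ≠ 0 := by
      obtain ⟨y, hy, hy'⟩ := h
      intro h0
      rw [probBit, Finset.sum_eq_zero_iff] at h0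
      have := h0 y (Finset.mem_univ _)
      rw [if_pos (by exact hy)] at this
      exact (μ.mem_support_iff y).1 hy' this
    rw [PMF.filter_apply, ← hs, Set.indicator_of_mem (by exact hx), mul_left_comm,
      ENNReal.mul_inv_cancel h0 (probBit_ne_top μ j b), mul_one]
  · rw [PMF.filter_apply, Set.indicator_of_notMem (by exact hx)]
    simp
  all_goals
    have h0 : probBit μ j b = 0 := by
      refine Finset.sum_eq_zero fun y _ => ?_
      split_ifs with hy
      · by_contra h1
        exact h ⟨y, hy, (μ.mem_support_iff y).2 h1⟩
      · rfl
    rw [h0, zero_mul]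
  by_contra h1
  exact h ⟨x, hx, (μ.mem_support_iff x).2 (Ne.symm h1)⟩

lemma support_condBit_subset (μ : PMF (Fin m → Bool)) (j : Fin m) (b : Bool) :
    (condBit μ j b).support ⊆ μ.support := by
  unfold condBit
  split_ifs with h
  · rw [PMF.support_filter]
    exact Set.inter_subset_right
  · exact subset_rfl

/-- The distributions of a block that simulates one hidden bit: `s b` is used if that bit is `b`. -/
abbrev BlockState (m : ℕ) := Bool → PMF (Fin m → Bool)

/-- Both distributions conditioned on bit `j` being `c`. -/
noncomputable def BlockState.condition (s : BlockState m) (j : Fin m) (c : Bool) : BlockState m :=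
  fun b => condBit (s b) j c

/-- The probability that the maximal coupling answers `c` without conflict. -/
noncomputable def BlockState.agree (s : BlockState m) (j : Fin m) (c : Bool) : ℝ≥0∞ :=
  min (probBit (s false) j c) (probBit (s true) j c)

/-- The probability that the maximal coupling gives different answers. -/
noncomputable def BlockState.conflictProb (s : BlockState m) (j : Fin m) : ℝ≥0∞ :=
  (probBit (s false) j false - probBit (s true) j false) +
    (probBit (s false) j true - probBit (s true) j true)

lemma agree_le_probBit (s : BlockState m) (j : Fin m) (c b : Bool) :
    s.agree j c ≤ probBit (s b) j c := by
  cases b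
  · exact min_le_left _ _
  · exact min_le_right _ _

lemma min_add_tsub_self (a b : ℝ≥0∞) : min a b + (a - b) = a := by
  rcases le_total a b with h | h
  · rw [min_eq_left h, tsub_eq_zero_of_le h, add_zero]
  · rw [min_eq_right h, add_tsub_cancel_of_le h]

lemma probBit_true_eq (μ : PMF (Fin m → Bool)) (j : Fin m) :
    probBit μ j true = 1 - probBit μ j false :=
  ENNReal.eq_sub_of_add_eq (probBit_ne_top _ _ _)
    (by rw [add_comm]; exact probBit_false_add_true μ j)

/-- Subtraction is truncated, so the excess of one law on answer 1 is the excess of the other on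
answer 0. This gives the coupling its second marginal and makes `conflictProb` the absolute
difference Δ. -/
lemma probBit_true_sub (μ ν : PMF (Fin m → Bool)) (j : Fin m) :
    probBit μ j true - probBit ν j true = probBit ν j false - probBit μ j false := by
  rw [probBit_true_eq, probBit_true_eq]
  have h1 := probBit_le_one μ j false
  have h2 := probBit_le_one ν j false
  have h3 := probBit_ne_top μ j false
  have h4 := probBit_ne_top ν j false
  generalize probBit μ j false = a at *
  generalize probBit ν j false = b at *
  lift a to NNReal using h3
  lift b to NNReal using h4
  norm_cast at *
  rw [← NNReal.coe_inj]
  rcases le_total a b with h | h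
  · rw [NNReal.coe_sub (tsub_le_tsub_left h 1), NNReal.coe_sub h, NNReal.coe_sub h1,
      NNReal.coe_sub h2]
    ring
  · rw [tsub_eq_zero_of_le h, tsub_eq_zero_of_le (tsub_le_tsub_left h 1)]

/-- The maximal coupling of bit `j` under `s false` and under `s true`. -/
noncomputable def BlockState.coupling (s : BlockState m) (j : Fin m) : PMF (Bool × Bool) :=
  PMF.ofFintype (fun a => if a.1 = a.2 then s.agree j a.1 else
    probBit (s false) j a.1 - probBit (s true) j a.1) (by
      simp only [Fintype.sum_prod_type, Fintype.sum_bool, BlockState.agree]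
      simp only [reduceCtorEq, if_true, if_false, Bool.false_eq_true]
      rw [add_comm (probBit (s false) j false - _), min_add_tsub_self, min_add_tsub_self,
        add_comm, probBit_false_add_true])

lemma expect_coupling (s : BlockState m) (j : Fin m) (F : Bool × Bool → ℝ≥0∞) :
    expect (s.coupling j) F =
      s.agree j false * F (false, false) + s.agree j true * F (true, true) +
      ((probBit (s false) j false - probBit (s true) j false) * F (false, true) +
        (probBit (s false) j true - probBit (s true) j true) * F (true, false)) := by
  rw [expect_fintype]
  simp [Fintype.sum_prod_type, BlockState.coupling, PMF.ofFintype_apply]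
  ring

lemma agree_add_conflictProb (s : BlockState m) (j : Fin m) :
    s.agree j false + s.agree j true + s.conflictProb j = 1 := by
  have := expect_coupling s j (fun _ => 1)
  rw [expect_const] at this
  simpa [BlockState.conflictProb] using this.symm

/-- The marginals of the coupling. -/
lemma expect_coupling_marginal (s : BlockState m) (j : Fin m) (b : Bool) (H : Bool → ℝ≥0∞) :
    expect (s.coupling j) (fun a => H (bif b then a.2 else a.1)) =
      ∑ c, probBit (s b) j c * H c := by
  rw [expect_coupling, Fintype.sum_bool]
  cases b
  · have h1 := min_add_tsub_self (probBit (s false) j true) (probBit (s true) j true)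
    have h2 := min_add_tsub_self (probBit (s false) j false) (probBit (s true) j false)
    simp only [cond_false, BlockState.agree]
    calc _ = (min (probBit (s false) j true) (probBit (s true) j true) +
          (probBit (s false) j true - probBit (s true) j true)) * H true +
          (min (probBit (s false) j false) (probBit (s true) j false) +
          (probBit (s false) j false - probBit (s true) j false)) * H false := by ring
      _ = _ := by rw [h1, h2]
  · have h1 := min_add_tsub_self (probBit (s true) j true) (probBit (s false) j true)
    have h2 := min_add_tsub_self (probBit (s true) j false) (probBit (s false) j false)
    rw [probBit_true_sub, min_comm] at h1
    rw [← probBit_true_sub, min_comm] at h2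
    simp only [cond_true, BlockState.agree]
    calc _ = (min (probBit (s false) j true) (probBit (s true) j true) +
          (probBit (s false) j false - probBit (s true) j false)) * H true +
          (min (probBit (s false) j false) (probBit (s true) j false) +
          (probBit (s false) j true - probBit (s true) j true)) * H false := by ring
      _ = _ := by rw [h1, h2]

lemma expect_coupling_conflict (s : BlockState m) (j : Fin m) (D : Bool → ℝ≥0∞) :
    expect (s.coupling j) (fun a => if a.1 = a.2 then D a.1 else 1) =
      s.conflictProb j + ∑ c, s.agree j c * D c := by
  rw [expect_coupling, Fintype.sum_bool]
  simp [BlockState.conflictProb]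
  ring

end Bit

/-! ### The simulation and the law of its output. -/

section Simulation

variable {n m : ℕ} {S : Type*}

/-- The state of a simulation of `n` blocks, each hiding one bit. -/
abbrev SimState (n m : ℕ) := Fin n → BlockState m

/-- The state after bit `j` of block `i` has been answered by `c` without conflict. -/
noncomputable def SimState.answer (σ : SimState n m) (i : Fin n) (j : Fin m) (c : Bool) :
    SimState n m :=
  Function.update σ i ((σ i).condition j c)

/-- The state after the hidden bit of block `i` has been found to be `b`, and bit `j` of this block
has been answered by `c`. -/
noncomputable def SimState.resolve (σ : SimState n m) (i : Fin n) (j : Fin m) (b c : Bool) :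
    SimState n m :=
  Function.update σ i fun _ => condBit (σ i b) j c

/-- The simulation of one query to bit `j` of block `i`, going on with `R` after the answer. The
hidden bit `i` is queried only if the maximal coupling of the two possible answers disagrees. -/
noncomputable def simStep (i : Fin n) (j : Fin m) (σ : SimState n m)
    (R : Bool → SimState n m → PMF (DecisionTree (Fin n) S)) : PMF (DecisionTree (Fin n) S) :=
  ((σ i).coupling j).bind fun a =>
    if a.1 = a.2 then R a.1 (σ.answer i j a.1)
    else (R a.1 (σ.resolve i j false a.1)).bind fun u₀ =>
      (R a.2 (σ.resolve i j true a.2)).map fun u₁ => .query i u₀ u₁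

/-- The simulation of a tree on `n` blocks by a random tree on the `n` hidden bits. -/
noncomputable def simulate : DecisionTree (Fin n × Fin m) S → SimState n m →
    PMF (DecisionTree (Fin n) S)
  | .leaf s, _ => PMF.pure (.leaf s)
  | .query ij t₀ t₁, σ =>
      simStep ij.1 ij.2 σ fun c => bif c then simulate t₁ else simulate t₀

/-- For a fixed input with hidden bit `b`, only branch `b` of a queried vertex matters. The cost `e`
of the query is 0 when outputs are tracked and 1 when queries are counted. -/
lemma expect_simStep (i : Fin n) (j : Fin m) (σ : SimState n m)
    (R : Bool → SimState n m → PMF (DecisionTree (Fin n) S))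
    (F : DecisionTree (Fin n) S → ℝ≥0∞) (e : ℝ≥0∞) (b : Bool)
    (hF : ∀ u₀ u₁, F (.query i u₀ u₁) = e + F (bif b then u₁ else u₀)) :
    expect (simStep i j σ R) F = expect ((σ i).coupling j) fun a =>
      if a.1 = a.2 then expect (R (bif b then a.2 else a.1)
        (σ.answer i j (bif b then a.2 else a.1))) F
      else e + expect (R (bif b then a.2 else a.1)
        (σ.resolve i j b (bif b then a.2 else a.1))) F := by
  rw [simStep, expect_bind]
  congr 1
  funext a
  split_ifs with h
  · cases b <;> simp [h]
  · simp only [expect_bind, expect_map, hF]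
    cases b <;> simp [expect_add, expect_const]

/-- The expectation of `h` if the blocks `x_i` are drawn independently from `σ i (z i)`. -/
noncomputable def inputExpect (σ : SimState n m) (z : Fin n → Bool)
    (h : (Fin n × Fin m → Bool) → ℝ≥0∞) : ℝ≥0∞ :=
  ∑ x, (∏ i, σ i (z i) (block x i)) * h x

lemma inputExpect_congr {σ τ : SimState n m} {z : Fin n → Bool}
    (hστ : ∀ i, σ i (z i) = τ i (z i)) (h : (Fin n × Fin m → Bool) → ℝ≥0∞) :
    inputExpect σ z h = inputExpect τ z h := by
  simp only [inputExpect, hστ]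

/-- The two updates differ only in the law for the wrong value of the hidden bit, so on input `z` a
conflict does not affect the law of later answers. -/
lemma resolve_apply (σ : SimState n m) (z : Fin n → Bool) (i : Fin n) (j : Fin m) (c : Bool)
    (k : Fin n) : σ.resolve i j (z i) c k (z k) = σ.answer i j c k (z k) := by
  unfold SimState.resolve SimState.answer
  rcases eq_or_ne k i with rfl | hk
  · simp [BlockState.condition]
  · simp [hk]

lemma inputExpect_const (σ : SimState n m) (z : Fin n → Bool) (c : ℝ≥0∞) :
    inputExpect σ z (fun _ => c) = c := by
  classical
  rw [inputExpect, ← Finset.sum_mul]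
  have h : ∑ x : Fin n × Fin m → Bool, ∏ i, σ i (z i) (block x i) = 1 := by
    rw [← (Equiv.curry (Fin n) (Fin m) Bool).symm.sum_comp]
    have h1 : ∀ i, ∑ y, σ i (z i) y = 1 := fun i => by
      rw [← (σ i (z i)).tsum_coe, tsum_fintype]
    have h2 := Finset.prod_univ_sum (fun _ : Fin n => (Finset.univ : Finset (Fin m → Bool)))
      (fun i y => σ i (z i) y)
    simp only [h1, Finset.prod_const_one, Fintype.piFinset_univ] at h2
    exact h2.symm
  rw [h, one_mul]

lemma inputExpect_add (σ : SimState n m) (z : Fin n → Bool)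
    (F G : (Fin n × Fin m → Bool) → ℝ≥0∞) :
    inputExpect σ z (fun x => F x + G x) = inputExpect σ z F + inputExpect σ z G := by
  simp only [inputExpect, mul_add, Finset.sum_add_distrib]

/-- The law of total expectation for bit `j` of block `i`. -/
lemma inputExpect_eq_sum_answer (σ : SimState n m) (z : Fin n → Bool) (i : Fin n) (j : Fin m)
    (h : (Fin n × Fin m → Bool) → ℝ≥0∞) (h' : Bool → (Fin n × Fin m → Bool) → ℝ≥0∞)
    (hh : ∀ x, h x = h' (x (i, j)) x) :
    inputExpect σ z h =
      ∑ c, probBit (σ i (z i)) j c * inputExpect (σ.answer i j c) z (h' c) := by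
  simp only [inputExpect, Finset.mul_sum]
  rw [Finset.sum_comm]
  refine Finset.sum_congr rfl fun x _ => ?_
  have key : ∀ c, probBit (σ i (z i)) j c *
      ((∏ k, σ.answer i j c k (z k) (block x k)) * h' c x) =
      if x (i, j) = c then (∏ k, σ k (z k) (block x k)) * h' c x else 0 := by
    intro c
    rw [← Finset.mul_prod_erase _ _ (Finset.mem_univ i),
      ← Finset.mul_prod_erase _ (fun k => σ k (z k) (block x k)) (Finset.mem_univ i)]
    have h1 : ∏ k ∈ Finset.univ.erase i, σ.answer i j c k (z k) (block x k) =
        ∏ k ∈ Finset.univ.erase i, σ k (z k) (block x k) := by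
      refine Finset.prod_congr rfl fun k hk => ?_
      rw [SimState.answer, Function.update_of_ne (Finset.ne_of_mem_erase hk)]
    have h2 := probBit_mul_condBit (σ i (z i)) j c (block x i)
    rw [h1, SimState.answer, Function.update_self, BlockState.condition, ← mul_assoc,
      ← mul_assoc, h2]
    by_cases hx : x (i, j) = c <;> simp [block, hx]
  simp only [key, hh x]
  simp

lemma output_query {ι : Type*} (i : ι) (t₀ t₁ : DecisionTree ι S) (x : ι → Bool) :
    (DecisionTree.query i t₀ t₁).output x = (bif x i then t₁ else t₀).output x := by
  rw [DecisionTree.output]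
  cases x i <;> simp

lemma numQueries_query {ι : Type*} (i : ι) (t₀ t₁ : DecisionTree ι S) (x : ι → Bool) :
    (DecisionTree.query i t₀ t₁).numQueries x = 1 + (bif x i then t₁ else t₀).numQueries x := by
  rw [DecisionTree.numQueries, add_comm]
  cases x i <;> simp

/-- The output of the simulation on `z` is distributed as the output of the simulated tree on
independent samples from the distributions `σ i (z i)`. -/
lemma expect_simulate_output (z : Fin n → Bool) (F : S → ℝ≥0∞) :
    ∀ (T : DecisionTree (Fin n × Fin m) S) (σ : SimState n m),
      expect (simulate T σ) (fun u => F (u.output z)) =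
        inputExpect σ z fun x => F (T.output x)
  | .leaf s, σ => by
    simp [simulate, expect_pure, DecisionTree.output, inputExpect_const]
  | .query (i, j) t₀ t₁, σ => by
    have ih₀ := expect_simulate_output z F t₀
    have ih₁ := expect_simulate_output z F t₁
    have ih : ∀ c τ, expect ((bif c then simulate t₁ else simulate t₀) τ)
        (fun u => F (u.output z)) =
        inputExpect τ z fun x => F ((bif c then t₁ else t₀).output x) := by
      intro c τ
      cases c
      · exact ih₀ τ
      · exact ih₁ τ
    rw [simulate, expect_simStep i j σ _ _ 0 (z i)
      (fun u₀ u₁ => by simp only [output_query, zero_add])]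
    -- The conflict and no-conflict cases now coincide, so only the marginal of the coupling
    -- belonging to `z i` is left.
    simp only [ih, zero_add,
      inputExpect_congr (fun k => resolve_apply σ z i j _ k), ite_self]
    rw [expect_coupling_marginal (σ i) j (z i) (fun c =>
        inputExpect (σ.answer i j c) z fun x => F ((bif c then t₁ else t₀).output x)),
      inputExpect_eq_sum_answer σ z i j _
        (fun c x => F ((bif c then t₁ else t₀).output x)) (fun x => by rw [output_query])]

/-! ### Conflicts and queries counted block by block. -/

/-- The expected total charge `e` of the queries to block `k` made by a tree up to the first
conflict in this block, if the hidden bits are `z`. -/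
noncomputable def expectedCharge (e : BlockState m → Fin m → ℝ≥0∞) (k : Fin n)
    (z : Fin n → Bool) : DecisionTree (Fin n × Fin m) S → SimState n m → ℝ≥0∞
  | .leaf _, _ => 0
  | .query ij t₀ t₁, σ =>
      (if ij.1 = k then e (σ k) ij.2 else 0) +
        ∑ c, (if ij.1 = k then (σ k).agree ij.2 c else probBit (σ ij.1 (z ij.1)) ij.2 c) *
          (bif c then expectedCharge e k z t₁ else expectedCharge e k z t₀)
            (σ.answer ij.1 ij.2 c)

lemma expectedCharge_query (e : BlockState m → Fin m → ℝ≥0∞) (k : Fin n) (z : Fin n → Bool)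
    (i : Fin n) (j : Fin m) (t₀ t₁ : DecisionTree (Fin n × Fin m) S) (σ : SimState n m) :
    expectedCharge e k z (.query (i, j) t₀ t₁) σ =
      (if i = k then e (σ k) j else 0) +
        ∑ c, (if i = k then (σ k).agree j c else probBit (σ i (z i)) j c) *
          expectedCharge e k z (bif c then t₁ else t₀) (σ.answer i j c) := by
  simp [expectedCharge]

/-- The charge of block `k` involves both laws of that block but only the laws selected by `z`
elsewhere; hence conflicts in other blocks leave it unchanged. -/
lemma expectedCharge_congr (e : BlockState m → Fin m → ℝ≥0∞) (k : Fin n) (z : Fin n → Bool) :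
    ∀ (T : DecisionTree (Fin n × Fin m) S) (σ τ : SimState n m), σ k = τ k →
      (∀ i, σ i (z i) = τ i (z i)) → expectedCharge e k z T σ = expectedCharge e k z T τ
  | .leaf _, _, _, _, _ => rfl
  | .query (i, j) t₀ t₁, σ, τ, hk, hz => by
    rw [expectedCharge_query, expectedCharge_query, hk, hz i]
    congr 1
    refine Finset.sum_congr rfl fun c _ => ?_
    congr 1
    have h1 : σ.answer i j c k = τ.answer i j c k := by
      unfold SimState.answer
      rcases eq_or_ne k i with rfl | hki
      · simp [hk]
      · simp [hki, hk]
    have h2 : ∀ l, σ.answer i j c l (z l) = τ.answer i j c l (z l) := by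
      intro l
      unfold SimState.answer
      rcases eq_or_ne l i with rfl | hli
      · simp [BlockState.condition, hz]
      · simp [hli, hz]
    cases c
    · exact expectedCharge_congr e k z t₀ _ _ h1 h2
    · exact expectedCharge_congr e k z t₁ _ _ h1 h2

/-- There is no conflict in a block whose hidden bit is known. -/
lemma expectedCharge_conflictProb_of_const (k : Fin n) (z : Fin n → Bool) :
    ∀ (T : DecisionTree (Fin n × Fin m) S) (σ : SimState n m), σ k false = σ k true →
      expectedCharge BlockState.conflictProb k z T σ = 0
  | .leaf _, _, _ => rfl
  | .query (i, j) t₀ t₁, σ, h => by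
    have h1 : ∀ c, σ.answer i j c k false = σ.answer i j c k true := by
      intro c
      unfold SimState.answer
      rcases eq_or_ne k i with rfl | hki
      · simp [BlockState.condition, h]
      · simp [hki, h]
    rw [expectedCharge_query, Fintype.sum_bool, cond_true, cond_false,
      expectedCharge_conflictProb_of_const k z t₀ _ (h1 false),
      expectedCharge_conflictProb_of_const k z t₁ _ (h1 true)]
    simp [BlockState.conflictProb, h]

/-- The expected number of queries of the simulation is the expected number of conflicts. -/
lemma expect_simulate_numQueries (z : Fin n → Bool) :
    ∀ (T : DecisionTree (Fin n × Fin m) S) (σ : SimState n m),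
      expect (simulate T σ) (fun u => (u.numQueries z : ℝ≥0∞)) =
        ∑ k, expectedCharge BlockState.conflictProb k z T σ
  | .leaf s, σ => by
    simp [simulate, expect_pure, DecisionTree.numQueries, expectedCharge]
  | .query (i, j) t₀ t₁, σ => by
    have ih : ∀ c τ, expect ((bif c then simulate t₁ else simulate t₀) τ)
        (fun u => (u.numQueries z : ℝ≥0∞)) =
        ∑ k, expectedCharge BlockState.conflictProb k z (bif c then t₁ else t₀) τ := by
      intro c τ
      cases c
      · exact expect_simulate_numQueries z t₀ τ
      · exact expect_simulate_numQueries z t₁ τ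
    rw [simulate, expect_simStep i j σ _ _ 1 (z i)
      (fun u₀ u₁ => by simp only [numQueries_query, Nat.cast_add, Nat.cast_one])]
    simp only [ih]
    set E : Fin n → Bool → ℝ≥0∞ := fun k c =>
      expectedCharge BlockState.conflictProb k z (bif c then t₁ else t₀) (σ.answer i j c) with hE
    have hres : ∀ c, ∑ k, expectedCharge BlockState.conflictProb k z (bif c then t₁ else t₀)
        (σ.resolve i j (z i) c) = ∑ k ∈ Finset.univ.erase i, E k c := by
      intro c
      rw [← Finset.add_sum_erase _ _ (Finset.mem_univ i),
        expectedCharge_conflictProb_of_const i z _ _ (by simp [SimState.resolve]), zero_add]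
      refine Finset.sum_congr rfl fun k hk => ?_
      refine expectedCharge_congr _ _ _ _ _ _ ?_ fun l => resolve_apply σ z i j c l
      simp [SimState.resolve, SimState.answer, Finset.ne_of_mem_erase hk]
    have hans : ∀ c, ∑ k, E k c = E i c + ∑ k ∈ Finset.univ.erase i, E k c := fun c =>
      (Finset.add_sum_erase _ _ (Finset.mem_univ i)).symm
    -- The charges of the other blocks are the same in both cases and depend only on the marginal
    -- answer; a conflict replaces the later charge of block `i` by the one query.
    have hsplit : ∀ a : Bool × Bool, (if a.1 = a.2 then
        ∑ k, E k (bif z i then a.2 else a.1)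
        else 1 + ∑ k, expectedCharge BlockState.conflictProb k z
          (bif (bif z i then a.2 else a.1) then t₁ else t₀)
          (σ.resolve i j (z i) (bif z i then a.2 else a.1))) =
        (if a.1 = a.2 then E i a.1 else 1) +
          ∑ k ∈ Finset.univ.erase i, E k (bif z i then a.2 else a.1) := by
      intro a
      rw [hres, hans]
      split_ifs with h
      · rw [h, Bool.cond_self]
      · rfl
    simp only [hE] at hsplit
    simp only [hsplit]
    rw [expect_add, expect_coupling_conflict (σ i) j (fun c =>
        expectedCharge BlockState.conflictProb i z (bif c then t₁ else t₀) (σ.answer i j c)),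
      expect_coupling_marginal (σ i) j (z i)
      (fun c => ∑ k ∈ Finset.univ.erase i, expectedCharge BlockState.conflictProb k z
        (bif c then t₁ else t₀) (σ.answer i j c)),
      ← Finset.add_sum_erase _ _ (Finset.mem_univ i)]
    congr 1
    · rw [expectedCharge_query]
      simp
    · simp only [Finset.mul_sum]
      rw [Finset.sum_comm]
      refine Finset.sum_congr rfl fun k hk => ?_
      rw [expectedCharge_query]
      simp [(Finset.ne_of_mem_erase hk).symm]

/-- The queries up to the first conflict in each block are at most all the queries. -/
lemma sum_expectedCharge_one_le (z : Fin n → Bool) :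
    ∀ (T : DecisionTree (Fin n × Fin m) S) (σ : SimState n m),
      ∑ k, expectedCharge (fun _ _ => 1) k z T σ ≤
        inputExpect σ z fun x => (T.numQueries x : ℝ≥0∞)
  | .leaf s, σ => by simp [expectedCharge]
  | .query (i, j) t₀ t₁, σ => by
    have ih : ∀ c τ, ∑ k, expectedCharge (fun _ _ => 1) k z (bif c then t₁ else t₀) τ ≤
        inputExpect τ z fun x => ((bif c then t₁ else t₀).numQueries x : ℝ≥0∞) := by
      intro c τ
      cases c
      · exact sum_expectedCharge_one_le z t₀ τ
      · exact sum_expectedCharge_one_le z t₁ τ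
    simp only [numQueries_query, Nat.cast_add, Nat.cast_one]
    rw [inputExpect_add, inputExpect_const, inputExpect_eq_sum_answer σ z i j _
      (fun c x => ((bif c then t₁ else t₀).numQueries x : ℝ≥0∞)) (fun x => rfl)]
    simp only [expectedCharge_query]
    rw [Finset.sum_add_distrib, Finset.sum_ite_eq]
    simp only [Finset.mem_univ, if_true]
    gcongr
    rw [Finset.sum_comm]
    refine Finset.sum_le_sum fun c _ => le_trans ?_ (mul_le_mul_right (ih c _) _)
    rw [Finset.mul_sum]
    refine Finset.sum_le_sum fun k _ => mul_le_mul_left ?_ _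
    -- In the queried block only the conflict-free mass is carried on, which is at most the
    -- probability of the answer.
    split_ifs with hik
    · rw [← hik]
      exact agree_le_probBit _ _ _ _
    · exact le_rfl

end Simulation

/-! ### Max conflict complexity as an expected number of queries. -/

section Conflict

variable {m : ℕ}

/-- The expected number of queries that a tree makes up to the first conflict. -/
noncomputable def queriesToConflict : DecisionTree (Fin m) Bool → BlockState m → ℝ≥0∞
  | .leaf _, _ => 0
  | .query j t₀ t₁, s =>
      1 + (s.agree j false * queriesToConflict t₀ (s.condition j false) +
        s.agree j true * queriesToConflict t₁ (s.condition j true))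

/-- `ν` is `μ` conditioned on the event `C` of positive probability. -/
def IsConditioned (μ : PMF (Fin m → Bool)) (C : Set (Fin m → Bool)) (ν : PMF (Fin m → Bool)) :
    Prop :=
  μ.toOuterMeasure C ≠ 0 ∧ ∀ x, μ.toOuterMeasure C * ν x = C.indicator μ x

lemma isConditioned_univ (μ : PMF (Fin m → Bool)) : IsConditioned μ Set.univ μ := by
  have h : μ.toOuterMeasure Set.univ = 1 := by
    rw [PMF.toOuterMeasure_apply, Set.indicator_univ, μ.tsum_coe]
  simp [IsConditioned, h]

lemma toOuterMeasure_ne_top (μ : PMF (Fin m → Bool)) (C : Set (Fin m → Bool)) :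
    μ.toOuterMeasure C ≠ ⊤ := by
  refine ne_top_of_le_ne_top ENNReal.one_ne_top ?_
  rw [PMF.toOuterMeasure_apply, ← μ.tsum_coe]
  exact ENNReal.tsum_le_tsum fun x => Set.indicator_le_self _ _ _

namespace IsConditioned

variable {μ ν : PMF (Fin m → Bool)} {C : Set (Fin m → Bool)}

lemma toOuterMeasure_inter (h : IsConditioned μ C ν) (j : Fin m) (b : Bool) :
    μ.toOuterMeasure {x | x ∈ C ∧ x j = b} = μ.toOuterMeasure C * probBit ν j b := by
  classical
  rw [PMF.toOuterMeasure_apply, tsum_fintype, probBit, Finset.mul_sum]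
  refine Finset.sum_congr rfl fun x _ => ?_
  by_cases hx : x j = b
  · rw [if_pos hx, h.2]
    simp [Set.indicator_apply, hx]
  · simp [hx]

lemma condProb_eq (h : IsConditioned μ C ν) (j : Fin m) (b : Bool) :
    condProb μ C j b = (probBit ν j b).toReal := by
  rw [condProb, h.toOuterMeasure_inter, mul_comm,
    ENNReal.mul_div_cancel_right h.1 (toOuterMeasure_ne_top _ _)]

lemma condBit (h : IsConditioned μ C ν) (j : Fin m) (b : Bool) (hb : probBit ν j b ≠ 0) :
    IsConditioned μ {x | x ∈ C ∧ x j = b} (condBit ν j b) := by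
  classical
  refine ⟨by rw [h.toOuterMeasure_inter]; exact mul_ne_zero h.1 hb, fun x => ?_⟩
  rw [h.toOuterMeasure_inter, mul_assoc, probBit_mul_condBit]
  by_cases hx : x j = b
  · rw [if_pos hx, h.2]
    simp [Set.indicator_apply, hx]
  · simp [hx]

lemma exists_mem (h : IsConditioned μ C ν) : ∃ x ∈ C, x ∈ μ.support := by
  by_contra! hC
  refine h.1 ?_
  rw [PMF.toOuterMeasure_apply_eq_zero_iff, Set.disjoint_right]
  exact hC

end IsConditioned

lemma conflictSum_zero (μ₀ μ₁ : PMF (Fin m → Bool)) :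
    ∀ (T : DecisionTree (Fin m) Bool) (C : Set (Fin m → Bool)) (d : ℕ),
      conflictSum μ₀ μ₁ T C d 0 = 0
  | .leaf _, _, _ => rfl
  | .query _ t₀ t₁, _, _ => by
    simp [conflictSum, conflictSum_zero μ₀ μ₁ t₀, conflictSum_zero μ₀ μ₁ t₁]

lemma condProb_nonneg (μ : PMF (Fin m → Bool)) (C : Set (Fin m → Bool)) (j : Fin m) (b : Bool) :
    0 ≤ condProb μ C j b := ENNReal.toReal_nonneg

lemma conflictSum_nonneg (μ₀ μ₁ : PMF (Fin m → Bool)) :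
    ∀ (T : DecisionTree (Fin m) Bool) (C : Set (Fin m → Bool)) (d : ℕ) (r : ℝ), 0 ≤ r →
      0 ≤ conflictSum μ₀ μ₁ T C d r
  | .leaf _, _, _, _, _ => le_rfl
  | .query j t₀ t₁, C, d, r, hr => by
    have h := fun b => mul_nonneg hr
      (le_min (condProb_nonneg μ₀ C j b) (condProb_nonneg μ₁ C j b))
    have h₀ := conflictSum_nonneg μ₀ μ₁ t₀ {x | x ∈ C ∧ x j = false} (d + 1) _ (h false)
    have h₁ := conflictSum_nonneg μ₀ μ₁ t₁ {x | x ∈ C ∧ x j = true} (d + 1) _ (h true)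
    rw [conflictSum]
    positivity

lemma ofReal_abs_toReal_sub {a b : ℝ≥0∞} (ha : a ≠ ⊤) (hb : b ≠ ⊤) :
    ENNReal.ofReal |a.toReal - b.toReal| = (a - b) + (b - a) := by
  rcases le_total a b with h | h
  · rw [abs_sub_comm, abs_of_nonneg (sub_nonneg.2 (ENNReal.toReal_mono hb h)),
      ← ENNReal.toReal_sub_of_le h hb, ENNReal.ofReal_toReal (ENNReal.sub_ne_top hb),
      tsub_eq_zero_of_le h, zero_add]
  · rw [abs_of_nonneg (sub_nonneg.2 (ENNReal.toReal_mono ha h)),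
      ← ENNReal.toReal_sub_of_le h ha, ENNReal.ofReal_toReal (ENNReal.sub_ne_top ha),
      tsub_eq_zero_of_le h, add_zero]

lemma ofReal_min_toReal {a b : ℝ≥0∞} (ha : a ≠ ⊤) (hb : b ≠ ⊤) :
    ENNReal.ofReal (min a.toReal b.toReal) = min a b := by
  rw [ENNReal.ofReal_min, ENNReal.ofReal_toReal ha, ENNReal.ofReal_toReal hb]

/-- The sum of `d(v) * Δ(v) * R(v)` is an expected number of queries, since every tree that
computes `g` ends in a conflict. -/
lemma ofReal_conflictSum {g : Set ((Fin m → Bool) × Bool)} (μ : BlockState m)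
    (hμ : ∀ b, (μ b).support ⊆ preim g b) :
    ∀ (T : DecisionTree (Fin m) Bool) (C : Set (Fin m → Bool)) (d : ℕ) (r : ℝ) (s : BlockState m),
      0 ≤ r → (r ≠ 0 → ∀ b, IsConditioned (μ b) C (s b)) → (∀ x ∈ C, (x, T.output x) ∈ g) →
      ENNReal.ofReal (conflictSum (μ false) (μ true) T C (d + 1) r) =
        ENNReal.ofReal r * (queriesToConflict T s + d)
  | .leaf b, C, d, r, s, hr, hs, hT => by
    -- Otherwise the leaf is reached by an input on which only `!b` is a correct output.
    have hr0 : r = 0 := by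
      by_contra h0
      obtain ⟨x, hx, hx'⟩ := (hs h0 (!b)).exists_mem
      have := (hμ _ hx').2
      rw [Bool.not_not] at this
      exact this (hT x hx)
    simp [hr0, conflictSum]
  | .query j t₀ t₁, C, d, r, s, hr, hs, hT => by
    rcases eq_or_ne r 0 with rfl | h0
    · simp [conflictSum_zero]
    replace hs := hs h0
    have hmin : ∀ b, 0 ≤ min (condProb (μ false) C j b) (condProb (μ true) C j b) := fun b =>
      le_min (condProb_nonneg _ _ _ _) (condProb_nonneg _ _ _ _)
    have hagree : ∀ b, ENNReal.ofReal (r * min (condProb (μ false) C j b)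
        (condProb (μ true) C j b)) = ENNReal.ofReal r * s.agree j b := by
      intro b
      rw [ENNReal.ofReal_mul hr, (hs false).condProb_eq, (hs true).condProb_eq,
        ofReal_min_toReal (probBit_ne_top _ _ _) (probBit_ne_top _ _ _), BlockState.agree]
    have hcond : ∀ c, r * min (condProb (μ false) C j c) (condProb (μ true) C j c) ≠ 0 →
        ∀ b, IsConditioned (μ b) {x | x ∈ C ∧ x j = c} (s.condition j c b) := by
      intro c hc b
      refine (hs b).condBit j c fun hb => hc ?_
      have h1 : min (condProb (μ false) C j c) (condProb (μ true) C j c) ≤ 0 := by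
        have h2 : condProb (μ b) C j c = 0 := by rw [(hs b).condProb_eq, hb]; rfl
        rw [← h2]
        cases b
        · exact min_le_left _ _
        · exact min_le_right _ _
      rw [le_antisymm h1 (hmin c), mul_zero]
    have ih₀ := ofReal_conflictSum μ hμ t₀ {x | x ∈ C ∧ x j = false} (d + 1) _
      (s.condition j false) (mul_nonneg hr (hmin false)) (hcond false)
      (fun x hx => by
        have := hT x hx.1
        rwa [output_query, hx.2] at this)
    have ih₁ := ofReal_conflictSum μ hμ t₁ {x | x ∈ C ∧ x j = true} (d + 1) _
      (s.condition j true) (mul_nonneg hr (hmin true)) (hcond true)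
      (fun x hx => by
        have := hT x hx.1
        rwa [output_query, hx.2] at this)
    have hΔ : ENNReal.ofReal |condProb (μ false) C j false - condProb (μ true) C j false| =
        s.conflictProb j := by
      rw [(hs false).condProb_eq, (hs true).condProb_eq,
        ofReal_abs_toReal_sub (probBit_ne_top _ _ _) (probBit_ne_top _ _ _),
        BlockState.conflictProb, probBit_true_sub]
    have hnn := fun b (t : DecisionTree (Fin m) Bool) =>
      conflictSum_nonneg (μ false) (μ true) t {x | x ∈ C ∧ x j = b} (d + 1 + 1) _
        (mul_nonneg hr (hmin b))
    rw [conflictSum, ENNReal.ofReal_add (add_nonneg (by positivity) (hnn false t₀)) (hnn true t₁),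
      ENNReal.ofReal_add (by positivity) (hnn false t₀), ih₀, ih₁, hagree, hagree,
      ENNReal.ofReal_mul (by positivity), ENNReal.ofReal_mul (by positivity), hΔ,
      ENNReal.ofReal_natCast, queriesToConflict]
    -- The depth offset `d + 1` is carried by both subtrees and by the conflict at this vertex,
    -- hence by total mass 1.
    calc _ = ENNReal.ofReal r * ((s.agree j false + s.agree j true + s.conflictProb j) * (d + 1) +
          (s.agree j false * queriesToConflict t₀ (s.condition j false) +
          s.agree j true * queriesToConflict t₁ (s.condition j true))) := by push_cast; ring
      _ = _ := by rw [agree_add_conflictProb]; ring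

/-- The pair `(μ₀, μ₁)` as the state of a block. -/
def pairState (p : PMF (Fin m → Bool) × PMF (Fin m → Bool)) : BlockState m :=
  fun b => bif b then p.2 else p.1

lemma ofReal_conflict {g : Set ((Fin m → Bool) × Bool)} {T : DecisionTree (Fin m) Bool}
    (hT : T.Computes g) (s : BlockState m) (hs : ∀ b, (s b).support ⊆ preim g b) :
    ENNReal.ofReal (conflict T (s false) (s true)) = queriesToConflict T s := by
  have := ofReal_conflictSum s hs T Set.univ 0 1 s zero_le_one
    (fun _ b => isConditioned_univ _) (fun x _ => hT x)
  simpa [conflict] using this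

lemma conflictExp_eq {g : Set ((Fin m → Bool) × Bool)} {T : DecisionTree (Fin m) Bool}
    (hT : T.Computes g) {Q : PMF (PMF (Fin m → Bool) × PMF (Fin m → Bool))}
    (hQ : Consistent g Q) :
    conflictExp T Q = expect Q fun p => queriesToConflict T (pairState p) := by
  refine tsum_congr fun p => ?_
  by_cases hp : Q p = 0
  · simp [hp]
  · have hp' := hQ p ((Q.mem_support_iff p).2 hp)
    simp only []
    rw [← ofReal_conflict hT (pairState p) (by rintro (_ | _); exacts [hp'.1, hp'.2])]
    rfl

/-- The tree that queries the bits `i` in the list `l` and outputs `F` of the answers. -/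
def queryAll {S : Type*} (F : (Fin m → Bool) → S) :
    List (Fin m) → (Fin m → Bool) → DecisionTree (Fin m) S
  | [], y => .leaf (F y)
  | i :: l, y => .query i (queryAll F l (Function.update y i false))
      (queryAll F l (Function.update y i true))

lemma output_queryAll {S : Type*} (F : (Fin m → Bool) → S) (x : Fin m → Bool) :
    ∀ (l : List (Fin m)) (y : Fin m → Bool), (∀ i ∉ l, y i = x i) →
      (queryAll F l y).output x = F x
  | [], y, h => by
    rw [queryAll, DecisionTree.output, funext fun i => h i List.not_mem_nil]
  | j :: l, y, h => by
    have key : ∀ c, x j = c → ∀ i ∉ l, Function.update y j c i = x i := by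
      intro c hc i hi
      rcases eq_or_ne i j with rfl | hij
      · simp [hc]
      · rw [Function.update_of_ne hij]
        exact h i (by simp [hij, hi])
    rw [queryAll, output_query]
    cases hc : x j
    · exact output_queryAll F x l _ (key _ hc)
    · exact output_queryAll F x l _ (key _ hc)

lemma exists_computes {g : Set ((Fin m → Bool) × Bool)} (hg : IsPartialBooleanFunction g) :
    ∃ T : DecisionTree (Fin m) Bool, T.Computes g := by
  have h : ∀ x, ∃ b, (x, b) ∈ g := by
    intro x
    by_cases hx : x ∈ validInputs g
    · rcases hx with hx | hx
      · exact ⟨_, hx.1⟩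
      · exact ⟨_, hx.1⟩
    · exact ⟨_, (hg x hx).1⟩
  choose F hF using h
  refine ⟨queryAll F (List.finRange m) fun _ => false, fun x => ?_⟩
  rw [output_queryAll F x _ _ (fun i hi => absurd (List.mem_finRange i) hi)]
  exact hF x

lemma exists_queriesToConflict_le (T : DecisionTree (Fin m) Bool) :
    ∃ d : ℕ, ∀ s, queriesToConflict T s ≤ d := by
  induction T with
  | leaf _ => exact ⟨0, fun _ => by simp [queriesToConflict]⟩
  | query j t₀ t₁ ih₀ ih₁ =>
    obtain ⟨d₀, h₀⟩ := ih₀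
    obtain ⟨d₁, h₁⟩ := ih₁
    refine ⟨1 + (d₀ + d₁), fun s => ?_⟩
    rw [queriesToConflict]
    push_cast
    have h : ∀ c, s.agree j c ≤ 1 := fun c =>
      (agree_le_probBit s j c false).trans (probBit_le_one _ _ _)
    gcongr
    · exact (mul_le_mul' (h _) (h₀ _)).trans_eq (one_mul _)
    · exact (mul_le_mul' (h _) (h₁ _)).trans_eq (one_mul _)

/-- A single tree computing `g` bounds the minimum for every `Q` at once. -/
lemma maxConflict_ne_top {g : Set ((Fin m → Bool) × Bool)} (hg : IsPartialBooleanFunction g) :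
    maxConflict g ≠ ⊤ := by
  obtain ⟨T, hT⟩ := exists_computes hg
  obtain ⟨d, hd⟩ := exists_queriesToConflict_le T
  refine ne_top_of_le_ne_top (ENNReal.natCast_ne_top d) ?_
  refine iSup₂_le fun Q hQ => iInf₂_le_of_le T hT ?_
  rw [conflictExp_eq hT hQ]
  exact (expect_mono Q fun p _ => hd _).trans_eq (expect_const _ _)

/-- For every weighted family of consistent states there is a tree computing `g` whose expected
number of queries up to a conflict is about as small as the max conflict complexity. -/
lemma exists_tree_le {g : Set ((Fin m → Bool) × Bool)} (hg : IsPartialBooleanFunction g)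
    {δ : ℝ≥0∞} (hδ : δ ≠ 0) {α : Type*} (r : α → ℝ≥0∞) (s : α → BlockState m)
    (hr : ∑' a, r a ≠ ⊤) (hs : ∀ a, r a ≠ 0 → ∀ b, (s a b).support ⊆ preim g b) :
    ∃ T : DecisionTree (Fin m) Bool, T.Computes g ∧
      ∑' a, r a * queriesToConflict T (s a) ≤ (maxConflict g + δ) * ∑' a, r a := by
  rcases eq_or_ne (∑' a, r a) 0 with h0 | h0
  · obtain ⟨T, hT⟩ := exists_computes hg
    rw [ENNReal.tsum_eq_zero] at h0
    exact ⟨T, hT, by simp [h0]⟩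
  -- Normalized, the family is itself a competitor in the maximum over `Q`, so its minimum over
  -- trees is at most `maxConflict g`; the slack δ replaces attainment of that minimum.
  set P : PMF α := PMF.normalize r h0 hr with hP
  set Q := P.map fun a => (s a false, s a true) with hQ
  have hPr : ∀ a ∈ P.support, ∀ b, (s a b).support ⊆ preim g b := by
    intro a ha
    refine hs a fun hra => (P.mem_support_iff a).1 ha ?_
    rw [hP, PMF.normalize_apply, hra, zero_mul]
  have hcons : Consistent g Q := by
    intro p hp
    rw [hQ, PMF.mem_support_map_iff] at hp
    obtain ⟨a, ha, rfl⟩ := hp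
    exact ⟨hPr a ha false, hPr a ha true⟩
  have hlt : ⨅ T : DecisionTree (Fin m) Bool, ⨅ _ : T.Computes g, conflictExp T Q <
      maxConflict g + δ := by
    refine lt_of_le_of_lt ?_ (ENNReal.lt_add_right (maxConflict_ne_top hg) hδ)
    exact le_iSup₂_of_le Q hcons le_rfl
  obtain ⟨T, hT⟩ := iInf_lt_iff.1 hlt
  obtain ⟨hT, hle⟩ := iInf_lt_iff.1 hT
  refine ⟨T, hT, ?_⟩
  rw [conflictExp_eq hT hcons, hQ, expect_map] at hle
  have hpair : ∀ a, pairState (s a false, s a true) = s a := by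
    intro a
    funext b
    cases b <;> rfl
  simp only [hpair] at hle
  calc ∑' a, r a * queriesToConflict T (s a)
      = (∑' a, r a) * expect P fun a => queriesToConflict T (s a) := by
        rw [expect, ← ENNReal.tsum_mul_left]
        refine tsum_congr fun a => ?_
        rw [hP, PMF.normalize_apply, ← mul_assoc, mul_left_comm,
          ENNReal.mul_inv_cancel h0 hr, mul_one]
    _ ≤ (∑' a, r a) * (maxConflict g + δ) := by gcongr
    _ = _ := mul_comm _ _

end Conflict

/-! ### From expected to worst-case query counts. -/

section Truncation

variable {ι S : Type*}

/-- Stop a tree after `k` queries, with some output if it has not yet finished. -/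
def truncate : ℕ → DecisionTree ι S → DecisionTree ι S
  | _, .leaf s => .leaf s
  -- Taking the leftmost leaf yields an output without assuming an element of `S`.
  | 0, .query _ t₀ _ => truncate 0 t₀
  | k + 1, .query i t₀ t₁ => .query i (truncate k t₀) (truncate k t₁)

lemma numQueries_truncate_le (T : DecisionTree ι S) (x : ι → Bool) :
    ∀ k, (truncate k T).numQueries x ≤ k := by
  induction T with
  | leaf s => intro k; simp [truncate, DecisionTree.numQueries]
  | query i t₀ t₁ ih₀ ih₁ =>
    rintro (_ | k)
    · exact ih₀ 0
    · rw [truncate, numQueries_query]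
      cases x i
      · have := ih₀ k
        simp only [cond_false]
        omega
      · have := ih₁ k
        simp only [cond_true]
        omega

lemma output_truncate (T : DecisionTree ι S) (x : ι → Bool) :
    ∀ k, T.numQueries x ≤ k → (truncate k T).output x = T.output x := by
  induction T with
  | leaf s => intro k _; simp [truncate]
  | query i t₀ t₁ ih₀ ih₁ =>
    rintro (_ | k) hk
    · rw [numQueries_query] at hk
      omega
    · rw [truncate, output_query, output_query]
      rw [numQueries_query] at hk
      cases hx : x i <;> rw [hx] at hk
      · exact ih₀ k (by simp only [cond_false] at hk; omega)
      · exact ih₁ k (by simp only [cond_true] at hk; omega)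

/-- By Markov's inequality, a bound on the expected number of queries gives a bound on the query
complexity, at the price of a larger error. -/
lemma randQueryComplexity_le_of_expect_le {f : Set ((ι → Bool) × S)} {ε γ : ℝ} (hγ : 0 ≤ γ)
    (B : RandomizedAlgorithm ι S) (hB : ComputesWithError B f ε) (k : ℕ)
    (hk : ∀ x, expect B (fun T => (T.numQueries x : ℝ≥0∞)) ≤ ENNReal.ofReal γ * (k + 1)) :
    randQueryComplexity (ε + γ) f ≤ k := by
  classical
  refine sInf_le ⟨B.map (truncate k), fun x => ?_, fun T hT x => ?_⟩
  · set P := expect B fun T => if T.numQueries x ≤ k then 0 else 1 with hP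
    have h1 : P ≤ ENNReal.ofReal γ := by
      -- Exceeding the budget `k` means at least `k + 1` queries, so Markov's inequality applies
      -- with `k + 1`.
      have h2 : ((k + 1 : ℕ) : ℝ≥0∞) * P ≤ ENNReal.ofReal γ * (k + 1) := by
        rw [hP, ← expect_mul_left]
        refine (expect_mono B fun T _ => ?_).trans (hk x)
        split_ifs with h
        · simp
        · rw [mul_one]
          exact_mod_cast not_le.1 h
      rw [mul_comm (ENNReal.ofReal γ)] at h2
      push_cast at h2
      exact (ENNReal.mul_le_mul_iff_right (by simp) (by finiteness)).1 h2
    have h3 : B.toOuterMeasure {T | (x, T.output x) ∈ f} ≤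
        (B.map (truncate k)).toOuterMeasure {T | (x, T.output x) ∈ f} + P := by
      rw [toOuterMeasure_eq_expect, toOuterMeasure_eq_expect, expect_map, hP, ← expect_add]
      refine expect_mono B fun T _ => ?_
      by_cases h : T.numQueries x ≤ k
      · simp [Set.indicator_apply, output_truncate T x k h]
      · rw [if_neg h]
        refine le_trans ?_ le_add_self
        exact Set.indicator_le_self' (fun _ _ => zero_le_one) _
    rw [← sub_sub, ENNReal.ofReal_sub _ hγ, tsub_le_iff_right]
    exact (hB x).trans (h3.trans (by gcongr))
  · rw [PMF.mem_support_map_iff] at hT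
    obtain ⟨T, -, rfl⟩ := hT
    exact_mod_cast numQueries_truncate_le T x k

end Truncation

/-! ### The price of a conflict and the composition theorem. -/

section Composition

variable {n m : ℕ} {S : Type*}

lemma answer_update_self (σ : SimState n m) (k : Fin n) (j : Fin m) (c : Bool)
    (s : BlockState m) :
    SimState.answer (Function.update σ k s) k j c = Function.update σ k (s.condition j c) := by
  simp [SimState.answer]

lemma answer_update_of_ne (σ : SimState n m) {i k : Fin n} (h : i ≠ k) (j : Fin m) (c : Bool)
    (s : BlockState m) :
    SimState.answer (Function.update σ k s) i j c =
      Function.update (SimState.answer σ i j c) k s := by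
  rw [SimState.answer, SimState.answer, Function.update_of_ne h, Function.update_comm h.symm]

/-- Arithmetic for a query to the distinguished block: the mass `R` splits into the conflict-free
parts `a₀`, `a₁` and the conflict `p`; `X`, `K` and `c` stand for the queries of the new tree, the
queries of the old tree and the later conflicts. -/
lemma sum_conflict_split_le {R χ p X₀ X₁ c₀ c₁ K₀ K₁ a₀ a₁ : ℝ≥0∞}
    (h₀ : X₀ + χ * c₀ ≤ K₀ + χ * a₀) (h₁ : X₁ + χ * c₁ ≤ K₁ + χ * a₁) (hR : R = a₀ + a₁ + p) :
    R + (X₀ + X₁) + (χ * p + (χ * c₁ + χ * c₀)) ≤ R + (K₁ + K₀) + χ * R :=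
  calc R + (X₀ + X₁) + (χ * p + (χ * c₁ + χ * c₀))
      = (X₀ + χ * c₀) + (X₁ + χ * c₁) + (R + χ * p) := by ring
    _ ≤ (K₀ + χ * a₀) + (K₁ + χ * a₁) + (R + χ * p) := by gcongr
    _ = R + (K₁ + K₀) + χ * (a₀ + a₁ + p) := by ring
    _ = R + (K₁ + K₀) + χ * R := by rw [← hR]

lemma convex_combination_le {p₀ p₁ A χ c₀ c₁ K₀ K₁ R : ℝ≥0∞} (hp : p₀ + p₁ = 1)
    (h₀ : p₀ * (A + χ * c₀) ≤ p₀ * (K₀ + χ * R)) (h₁ : p₁ * (A + χ * c₁) ≤ p₁ * (K₁ + χ * R)) :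
    A + (χ * (p₁ * c₁) + χ * (p₀ * c₀)) ≤ p₁ * K₁ + p₀ * K₀ + χ * R :=
  calc A + (χ * (p₁ * c₁) + χ * (p₀ * c₀))
      = (p₀ + p₁) * A + (χ * (p₁ * c₁) + χ * (p₀ * c₀)) := by rw [hp, one_mul]
    _ = p₀ * (A + χ * c₀) + p₁ * (A + χ * c₁) := by ring
    _ ≤ p₀ * (K₀ + χ * R) + p₁ * (K₁ + χ * R) := add_le_add h₀ h₁
    _ = p₁ * K₁ + p₀ * K₀ + (p₀ + p₁) * (χ * R) := by ring
    _ = p₁ * K₁ + p₀ * K₀ + χ * R := by rw [hp, one_mul]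

/-- A tree on `n` blocks can be turned into a tree computing `g` by following its queries to block
`k` and then, if there has been no conflict, using a good tree for the remaining distribution. -/
lemma exists_tree_add_le {g : Set ((Fin m → Bool) × Bool)} (hg : IsPartialBooleanFunction g)
    {δ : ℝ≥0∞} (hδ : δ ≠ 0) {α : Type*} (k : Fin n) (z : Fin n → Bool) :
    ∀ (T : DecisionTree (Fin n × Fin m) S) (r : α → ℝ≥0∞) (s : α → BlockState m)
      (σ : SimState n m), ∑' a, r a ≠ ⊤ →
      (∀ a, r a ≠ 0 → ∀ b, (s a b).support ⊆ preim g b) →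
      ∃ T' : DecisionTree (Fin m) Bool, T'.Computes g ∧
        ∑' a, r a * queriesToConflict T' (s a) + (maxConflict g + δ) *
          ∑' a, r a * expectedCharge BlockState.conflictProb k z T (Function.update σ k (s a)) ≤
        ∑' a, r a * expectedCharge (fun _ _ => 1) k z T (Function.update σ k (s a)) +
          (maxConflict g + δ) * ∑' a, r a
  -- The weights `r` are the mass without conflict so far; here the good continuation is attached.
  | .leaf _, r, s, σ, hr, hs => by
    obtain ⟨T', hT', h⟩ := exists_tree_le hg hδ r s hr hs
    exact ⟨T', hT', by simpa [expectedCharge] using h⟩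
  | .query (i, j) t₀ t₁, r, s, σ, hr, hs => by
    generalize hχ : maxConflict g + δ = χ
    rcases eq_or_ne i k with rfl | hik
    · have hr' : ∀ c, ∑' a, r a * (s a).agree j c ≠ ⊤ := fun c =>
        ne_top_of_le_ne_top hr (ENNReal.tsum_le_tsum fun a => mul_le_of_le_one_right'
          ((agree_le_probBit (s a) j c false).trans (probBit_le_one _ _ _)))
      have hs' : ∀ c a, r a * (s a).agree j c ≠ 0 →
          ∀ b, ((s a).condition j c b).support ⊆ preim g b := fun c a ha b =>
        (support_condBit_subset _ _ _).trans (hs a (left_ne_zero_of_mul ha) b)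
      obtain ⟨T₀, hT₀, h₀⟩ := exists_tree_add_le hg hδ i z t₀ _ _ σ (hr' false) (hs' false)
      obtain ⟨T₁, hT₁, h₁⟩ := exists_tree_add_le hg hδ i z t₁ _ _ σ (hr' true) (hs' true)
      refine ⟨.query j T₀ T₁, fun x => ?_, ?_⟩
      · rw [output_query]
        cases x j
        · exact hT₀ x
        · exact hT₁ x
      rw [hχ] at h₀ h₁
      have hsum : ∑' a, r a = ∑' a, r a * (s a).agree j false + ∑' a, r a * (s a).agree j true +
          ∑' a, r a * (s a).conflictProb j := by
        rw [← ENNReal.tsum_add, ← ENNReal.tsum_add]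
        refine tsum_congr fun a => ?_
        rw [← mul_add, ← mul_add, agree_add_conflictProb, mul_one]
      simp only [expectedCharge_query, Function.update_self, answer_update_self, if_true,
        Fintype.sum_bool, queriesToConflict, mul_add, ENNReal.tsum_add, ← mul_assoc, mul_one,
        cond_true, cond_false]
      exact sum_conflict_split_le h₀ h₁ hsum
    -- A query to another block is random and independent of block `k`, so it is not copied: the new
    -- tree is whichever of `T₀`, `T₁` has the smaller expected number of queries up to a conflict,
    -- and the bound is an average over the answers.
    · obtain ⟨T₀, hT₀, h₀⟩ := exists_tree_add_le hg hδ k z t₀ r s (σ.answer i j false) hr hs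
      obtain ⟨T₁, hT₁, h₁⟩ := exists_tree_add_le hg hδ k z t₁ r s (σ.answer i j true) hr hs
      rw [hχ] at h₀ h₁
      have key : ∀ A, A ≤ ∑' a, r a * queriesToConflict T₀ (s a) →
          A ≤ ∑' a, r a * queriesToConflict T₁ (s a) →
          A + χ * ∑' a, r a * expectedCharge BlockState.conflictProb k z (.query (i, j) t₀ t₁)
            (Function.update σ k (s a)) ≤
          ∑' a, r a * expectedCharge (fun _ _ => 1) k z (.query (i, j) t₀ t₁)
            (Function.update σ k (s a)) + χ * ∑' a, r a := by
        intro A hA₀ hA₁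
        simp only [expectedCharge_query, if_neg hik, answer_update_of_ne _ hik,
          Function.update_of_ne hik, zero_add, Fintype.sum_bool, cond_true, cond_false, mul_add,
          ENNReal.tsum_add, mul_left_comm (r _), ENNReal.tsum_mul_left]
        have hp := probBit_false_add_true (σ i (z i)) j
        replace h₀ := mul_le_mul_right ((add_le_add_left hA₀ _).trans h₀)
          (probBit (σ i (z i)) j false)
        replace h₁ := mul_le_mul_right ((add_le_add_left hA₁ _).trans h₁)
          (probBit (σ i (z i)) j true)
        exact convex_combination_le hp h₀ h₁
      rcases le_total (∑' a, r a * queriesToConflict T₀ (s a))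
        (∑' a, r a * queriesToConflict T₁ (s a)) with h | h
      · exact ⟨T₀, hT₀, key _ le_rfl h⟩
      · exact ⟨T₁, hT₁, key _ h le_rfl⟩

/-- The simulation with independent initial pairs of distributions drawn from `Q`. -/
noncomputable def simulateIid (Q : PMF (PMF (Fin m → Bool) × PMF (Fin m → Bool)))
    (T : DecisionTree (Fin n × Fin m) S) : PMF (DecisionTree (Fin n) S) :=
  (iid Q n).bind fun p => simulate T fun i => pairState (p i)

lemma pairState_update (p : Fin n → PMF (Fin m → Bool) × PMF (Fin m → Bool)) (k : Fin n)
    (a : PMF (Fin m → Bool) × PMF (Fin m → Bool)) :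
    (fun i => pairState (Function.update p k a i)) =
      Function.update (fun i => pairState (p i)) k (pairState a) := by
  funext i
  rcases eq_or_ne i k with rfl | h
  · simp
  · simp [h]

lemma support_pairState {g : Set ((Fin m → Bool) × Bool)}
    {Q : PMF (PMF (Fin m → Bool) × PMF (Fin m → Bool))} (hQ : Consistent g Q)
    {p : PMF (Fin m → Bool) × PMF (Fin m → Bool)} (hp : p ∈ Q.support) (b : Bool) :
    (pairState p b).support ⊆ preim g b := by
  cases b
  · exact (hQ p hp).1
  · exact (hQ p hp).2

/-- Near-optimality of `Q` bounds the tree of `exists_tree_add_le` from below by `maxConflict g`,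
which is finite and cancels against the total mass 1 of `Q`. One δ comes from the choice of `Q`, the
other from the continuation trees. -/
lemma maxConflict_mul_expectedCharge_le {g : Set ((Fin m → Bool) × Bool)}
    (hg : IsPartialBooleanFunction g) {δ : ℝ≥0∞} (hδ : δ ≠ 0)
    {Q : PMF (PMF (Fin m → Bool) × PMF (Fin m → Bool))} (hQ : Consistent g Q)
    (hopt : ∀ T : DecisionTree (Fin m) Bool, T.Computes g → maxConflict g ≤ conflictExp T Q + δ)
    (T : DecisionTree (Fin n × Fin m) S) (z : Fin n → Bool) (k : Fin n) (σ : SimState n m) :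
    maxConflict g * expect Q (fun a => expectedCharge BlockState.conflictProb k z T
        (Function.update σ k (pairState a))) ≤
      expect Q (fun a => expectedCharge (fun _ _ => 1) k z T
        (Function.update σ k (pairState a))) + 2 * δ := by
  obtain ⟨T', hT', h⟩ := exists_tree_add_le hg hδ k z T (fun a => Q a) pairState σ
    (by rw [Q.tsum_coe]; exact ENNReal.one_ne_top)
    (fun a ha => support_pairState hQ ((Q.mem_support_iff a).2 ha))
  have h1 := hopt T' hT'
  rw [conflictExp_eq hT' hQ] at h1
  rw [Q.tsum_coe, mul_one] at h
  simp only [expect] at h1 ⊢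
  generalize hX : ∑' a, Q a * queriesToConflict T' (pairState a) = X at h h1
  generalize hC : ∑' a, Q a * expectedCharge BlockState.conflictProb k z T
    (Function.update σ k (pairState a)) = C at h ⊢
  generalize hK : ∑' a, Q a * expectedCharge (fun _ _ => 1) k z T
    (Function.update σ k (pairState a)) = K at h ⊢
  have hfin := maxConflict_ne_top hg
  generalize maxConflict g = χ at *
  refine (ENNReal.add_le_add_iff_left hfin).1 ?_
  calc χ + χ * C ≤ (X + δ) + (χ + δ) * C := by gcongr; exact le_self_add
    _ = (X + (χ + δ) * C) + δ := by ring
    _ ≤ (K + (χ + δ)) + δ := by gcongr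
    _ = χ + (K + 2 * δ) := by ring

lemma maxConflict_mul_expect_numQueries_le {g : Set ((Fin m → Bool) × Bool)}
    (hg : IsPartialBooleanFunction g) {δ : ℝ≥0∞} (hδ : δ ≠ 0)
    {Q : PMF (PMF (Fin m → Bool) × PMF (Fin m → Bool))} (hQ : Consistent g Q)
    (hopt : ∀ T : DecisionTree (Fin m) Bool, T.Computes g → maxConflict g ≤ conflictExp T Q + δ)
    (T : DecisionTree (Fin n × Fin m) S) (q : ℕ) (hT : ∀ x, T.numQueries x ≤ q)
    (z : Fin n → Bool) :
    maxConflict g * expect (simulateIid Q T) (fun u => (u.numQueries z : ℝ≥0∞)) ≤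
      q + n * (2 * δ) := by
  simp only [simulateIid, expect_bind, expect_simulate_numQueries]
  rw [expect_sum, Finset.mul_sum]
  calc _ ≤ ∑ k, (expect (iid Q n) (fun p => expectedCharge (fun _ _ => 1) k z T
          fun i => pairState (p i)) + 2 * δ) := by
        refine Finset.sum_le_sum fun k _ => ?_
        -- With the pairs of the other blocks frozen, only the pair of block `k` is averaged, as in
        -- the one-block bound.
        rw [expect_iid_resample Q k,
          expect_iid_resample Q k (fun p => expectedCharge (fun _ _ => 1) k z T
            fun i => pairState (p i)), ← expect_mul_left,
          ← expect_const (iid Q n) (2 * δ), ← expect_add]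
        refine expect_mono _ fun p _ => ?_
        simp only [pairState_update]
        exact maxConflict_mul_expectedCharge_le hg hδ hQ hopt T z k _
    _ = expect (iid Q n) (fun p => ∑ k, expectedCharge (fun _ _ => 1) k z T
          fun i => pairState (p i)) + n * (2 * δ) := by
        rw [Finset.sum_add_distrib, expect_sum, Finset.sum_const, Finset.card_univ,
          Fintype.card_fin, nsmul_eq_mul]
    _ ≤ _ := by
        gcongr
        rw [← expect_const (iid Q n) (q : ℝ≥0∞)]
        refine expect_mono _ fun p _ => (sum_expectedCharge_one_le z T _).trans ?_
        rw [← inputExpect_const (fun i => pairState (p i)) z q]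
        refine Finset.sum_le_sum fun x _ => ?_
        exact mul_le_mul_right (Nat.cast_le.2 (hT x)) _

lemma mem_compose_iff {f : Set ((Fin n → Bool) × S)} {g : Set ((Fin m → Bool) × Bool)}
    {x : Fin n × Fin m → Bool} {z : Fin n → Bool} (hx : ∀ i, block x i ∈ preim g (z i)) (s : S) :
    (x, s) ∈ compose f g ↔ (z, s) ∈ f := by
  have hvalid : ∀ i, block x i ∈ validInputs g := by
    intro i
    have := hx i
    cases hz : z i <;> rw [hz] at this
    · exact Or.inl this
    · exact Or.inr this
  constructor
  · rintro (⟨i, hi⟩ | ⟨w, hw, hwf⟩)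
    · exact absurd (hvalid i) hi
    · have : w = z := by
        funext i
        by_contra h
        have h1 := (hw i).2
        have h2 : (!w i) = z i := by
          cases hw : w i <;> cases hz : z i <;> simp_all
        rw [h2] at h1
        exact h1 (hx i).1
      rwa [← this]
  · exact fun h => Or.inr ⟨z, hx, h⟩

/-- Every sampled input has blocks of value `z i`, where correctness for the composition is
correctness for `f` at `z`; the success probability is thus an average of success probabilities of
`A`. -/
lemma computesWithError_simulateIid {f : Set ((Fin n → Bool) × S)}
    {g : Set ((Fin m → Bool) × Bool)} {ε : ℝ}
    {Q : PMF (PMF (Fin m → Bool) × PMF (Fin m → Bool))} (hQ : Consistent g Q)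
    {A : RandomizedAlgorithm (Fin n × Fin m) S} (hA : ComputesWithError A (compose f g) ε) :
    ComputesWithError (A.bind (simulateIid Q)) f ε := by
  classical
  intro z
  have hind : ({T | (z, T.output z) ∈ f} : Set (DecisionTree (Fin n) S)).indicator
      (1 : DecisionTree (Fin n) S → ℝ≥0∞) =
        fun u => (fun s => if (z, s) ∈ f then (1 : ℝ≥0∞) else 0) (u.output z) := by
    funext u
    simp [Set.indicator_apply]
  rw [toOuterMeasure_eq_expect, hind, expect_bind]
  simp only [simulateIid, expect_bind]
  rw [expect_comm, ← expect_const (iid Q n) (ENNReal.ofReal (1 - ε))]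
  refine expect_mono _ fun p hp => ?_
  simp only [expect_simulate_output z (fun s => if (z, s) ∈ f then (1 : ℝ≥0∞) else 0)]
  simp only [inputExpect]
  rw [expect_sum, ← inputExpect_const (fun i => pairState (p i)) z (ENNReal.ofReal (1 - ε))]
  refine Finset.sum_le_sum fun x _ => ?_
  rw [expect_mul_left]
  by_cases hx : ∏ i, pairState (p i) (z i) (block x i) = 0
  · simp [hx]
  gcongr
  have hval : ∀ i, block x i ∈ preim g (z i) := fun i =>
    support_pairState hQ (mem_support_of_mem_support_iid Q hp i) (z i)
      (((pairState (p i) (z i)).mem_support_iff _).2 fun h0 =>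
        hx (Finset.prod_eq_zero (Finset.mem_univ i) h0))
  refine (hA x).trans_eq ?_
  rw [toOuterMeasure_eq_expect]
  congr 1
  funext T
  simp [Set.indicator_apply, mem_compose_iff hval]

lemma exists_near_optimal {g : Set ((Fin m → Bool) × Bool)} (hg : IsPartialBooleanFunction g)
    (h0 : maxConflict g ≠ 0) {δ : ℝ≥0∞} (hδ : δ ≠ 0) :
    ∃ Q : PMF (PMF (Fin m → Bool) × PMF (Fin m → Bool)), Consistent g Q ∧
      ∀ T : DecisionTree (Fin m) Bool, T.Computes g → maxConflict g ≤ conflictExp T Q + δ := by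
  have hlt := ENNReal.sub_lt_self (maxConflict_ne_top hg) h0 hδ
  conv_rhs at hlt => rw [maxConflict]
  obtain ⟨Q, hlt⟩ := lt_iSup_iff.1 hlt
  obtain ⟨hQ, hlt⟩ := lt_iSup_iff.1 hlt
  refine ⟨Q, hQ, fun T hT => tsub_le_iff_right.1 (hlt.le.trans ?_)⟩
  exact iInf₂_le T hT

/-- A composition theorem for a given algorithm for `f ∘ g^n`. -/
lemma randQueryComplexity_mul_maxConflict_le {f : Set ((Fin n → Bool) × S)}
    {g : Set ((Fin m → Bool) × Bool)} (hg : IsPartialBooleanFunction g) {ε γ : ℝ} (hγ : 0 < γ)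
    {A : RandomizedAlgorithm (Fin n × Fin m) S} (hA : ComputesWithError A (compose f g) ε)
    (q : ℕ) (hq : ∀ T ∈ A.support, ∀ x, T.numQueries x ≤ q) :
    ENNReal.ofReal γ * ((randQueryComplexity (ε + γ) f : ℝ≥0∞) * maxConflict g) ≤ q := by
  -- If χ is 0 there may be no consistent `Q`; the bound then holds by `⊤ * 0 = 0`, even if `f` has
  -- infinite complexity.
  rcases eq_or_ne (maxConflict g) 0 with h0 | h0
  · simp [h0]
  have hfin := maxConflict_ne_top hg
  have hγ0 : ENNReal.ofReal γ ≠ 0 := by simpa using hγ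
  have main : ∀ δ : ℝ≥0∞, δ ≠ 0 → δ ≠ ⊤ →
      ENNReal.ofReal γ * ((randQueryComplexity (ε + γ) f : ℝ≥0∞) * maxConflict g) ≤
        q + n * (2 * δ) := by
    intro δ hδ hδ'
    obtain ⟨Q, hQ, hopt⟩ := exists_near_optimal hg h0 hδ
    set M : ℝ≥0∞ := q + n * (2 * δ) with hM
    have hMfin : M ≠ ⊤ := by rw [hM]; finiteness
    have hexp : ∀ z, expect (A.bind (simulateIid Q)) (fun u => (u.numQueries z : ℝ≥0∞)) ≤
        M / maxConflict g := by
      intro z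
      rw [ENNReal.le_div_iff_mul_le (Or.inl h0) (Or.inl hfin), mul_comm, expect_bind,
        ← expect_mul_left, ← expect_const A M]
      exact expect_mono A fun T hT =>
        maxConflict_mul_expect_numQueries_le hg hδ hQ hopt T q (hq T hT) z
    -- `N` is the Markov budget. Its floor `k` satisfies `N ≤ k + 1`, which is what the truncation
    -- needs, and `k ≤ N`, so rounding loses nothing.
    set N : ℝ≥0∞ := M / maxConflict g / ENNReal.ofReal γ with hN
    have hNfin : N ≠ ⊤ := ENNReal.div_ne_top (ENNReal.div_ne_top hMfin h0) hγ0
    have hNeq : ENNReal.ofReal γ * (N * maxConflict g) = M := by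
      rw [← mul_assoc, hN, ENNReal.mul_div_cancel hγ0 ENNReal.ofReal_ne_top,
        ENNReal.div_mul_cancel h0 hfin]
    have hle : N ≤ (⌊N.toReal⌋₊ : ℝ≥0∞) + 1 := by
      rw [← ENNReal.ofReal_toReal hNfin]
      refine (ENNReal.ofReal_le_ofReal (Nat.lt_floor_add_one _).le).trans_eq ?_
      rw [ENNReal.ofReal_add (Nat.cast_nonneg _) zero_le_one, ENNReal.ofReal_natCast,
        ENNReal.ofReal_one, ENNReal.toReal_ofReal ENNReal.toReal_nonneg]
    have hge : (⌊N.toReal⌋₊ : ℝ≥0∞) ≤ N := by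
      rw [← ENNReal.ofReal_natCast]
      exact ENNReal.ofReal_le_of_le_toReal (Nat.floor_le ENNReal.toReal_nonneg)
    have hR := randQueryComplexity_le_of_expect_le hγ.le _
      (computesWithError_simulateIid hQ hA) ⌊N.toReal⌋₊ (fun z => by
        refine (hexp z).trans ?_
        rw [← ENNReal.mul_div_cancel hγ0 ENNReal.ofReal_ne_top (b := M / maxConflict g), ← hN]
        gcongr)
    rw [← hNeq]
    gcongr
    refine le_trans ?_ hge
    exact_mod_cast ENat.toENNReal_le.2 hR
  -- Let δ tend to 0; the denominator uses `n + 1` so that `n = 0` is allowed.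
  refine ENNReal.le_of_forall_pos_le_add fun η hη _ => ?_
  have hden : (2 * (n + 1) : ℝ≥0∞) ≠ 0 := by positivity
  have hden' : (2 * (n + 1) : ℝ≥0∞) ≠ ⊤ := by finiteness
  refine (main (η / (2 * (n + 1))) ?_ (ENNReal.div_ne_top ENNReal.coe_ne_top hden)).trans ?_
  · exact ENNReal.div_ne_zero.2 ⟨by exact_mod_cast hη.ne', hden'⟩
  · gcongr
    calc (n : ℝ≥0∞) * (2 * (η / (2 * (n + 1)))) ≤ (n + 1) * (2 * (η / (2 * (n + 1)))) := by
          gcongr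
          exact le_self_add
      _ = 2 * (n + 1) * (η / (2 * (n + 1))) := by ring
      _ = η := ENNReal.mul_div_cancel hden hden'

end Composition

end QueryComplexity

theorem theorem2 :
    ∃ c : ℝ, 0 < c ∧
      ∀ (n m : ℕ) (S : Type*) (f : Set ((Fin n → Bool) × S)) (g : Set ((Fin m → Bool) × Bool)),
        QueryComplexity.IsPartialBooleanFunction g →
        ENNReal.ofReal c *
            ((QueryComplexity.randQueryComplexity (4 / 9) f : ℝ≥0∞) *
              QueryComplexity.maxConflict g) ≤
          (QueryComplexity.randQueryComplexity (1 / 3) (QueryComplexity.compose f g) : ℝ≥0∞) := by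
  -- The constant is the error spent in Markov's inequality, 4/9 − 1/3.
  refine ⟨1 / 9, by norm_num, fun n m S f g hg => ?_⟩
  rcases eq_or_ne (QueryComplexity.randQueryComplexity (1 / 3) (QueryComplexity.compose f g)) ⊤
    with htop | htop
  · rw [htop]
    exact le_top
  lift QueryComplexity.randQueryComplexity (1 / 3) (QueryComplexity.compose f g) to ℕ
    using htop with q hq
  -- A finite infimum means a nonempty set, and in `ℕ∞` the infimum is then attained by an
  -- algorithm.
  have hne : {q : ℕ∞ | ∃ A : QueryComplexity.RandomizedAlgorithm (Fin n × Fin m) S,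
      QueryComplexity.ComputesWithError A (QueryComplexity.compose f g) (1 / 3) ∧
      ∀ T ∈ A.support, ∀ x, (T.numQueries x : ℕ∞) ≤ q}.Nonempty := by
    by_contra h
    rw [Set.not_nonempty_iff_eq_empty] at h
    rw [QueryComplexity.randQueryComplexity, h, sInf_empty] at hq
    exact ENat.natCast_ne_top q hq
  obtain ⟨A, hA, hAq⟩ := csInf_mem hne
  rw [← QueryComplexity.randQueryComplexity, ← hq] at hAq
  have h := QueryComplexity.randQueryComplexity_mul_maxConflict_le (γ := 1 / 9) hg (by norm_num) hA
    q fun T hT x => by exact_mod_cast hAq T hT x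
  rw [show (1 / 3 + 1 / 9 : ℝ) = 4 / 9 by norm_num] at h
  exact_mod_cast h
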